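/- Call a nondegenerate (i.e. having at least two points) metrizable space $X$ a *space with enough arcs* if for every nonempty proper closed set $A\subset X$ there is an arc in $X$ (a homeomorphic copy of $[0,1]$) with one endpoint in $A$ and the other in $X\setminus A$. (1) Every nondegenerate metrizable space $X$ admitting a minimal continuous flow (a continuous action of $\mathbb R$ on $X$ all of whose orbits are dense) has enough arcs. (2) Let $X$ be a nondegenerate metrizable continuum (compact connected metrizable space), and for $p\in X$ let the composant of $p$ be the union of all proper subcontinua (nonempty compact connected subsets different from $X$) containing $p$. If every composant of $X$ is arcwise connected (any two of its distinct points are the endpoints of an arc contained in it), then $X$ has enough arcs. In particular, let $X$ be a solenoid or a Knaster continuum, i.e. a space homeomorphic to the inverse limit of a sequence $Y\xleftarrow{f_0}Y\xleftarrow{f_1}Y\xleftarrow{f_2}\cdots$, where $Y$ is the circle (solenoids) or the arc $[0,1]$ (Knaster continua) and each $f_n\colon Y\to Y$ is continuous, open and not a homeomorphism. Then $X$ is a nondegenerate metrizable continuum all of whose composants are arcwise connected, and $X$ has enough arcs. -/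

import Mathlib

open Set Topology TopologicalSpace

universe u

/-- `J` is an arc in `X` with endpoints `a` and `b`: a homeomorphic copy of `[0,1]`, the
homeomorphism taking `0` to `a` and `1` to `b`. -/
def IsArcFromTo {X : Type u} [TopologicalSpace X] (J : Set X) (a b : X) : Prop :=
  ∃ γ : unitInterval → X, IsEmbedding γ ∧ range γ = J ∧ γ 0 = a ∧ γ 1 = b

/-- A space with enough arcs: a nondegenerate metrizable space in which every nonempty proper
closed set can be joined to its complement by an arc. -/
structure HasEnoughArcs (X : Type u) [TopologicalSpace X] : Prop where
  nondegenerate : Nontrivial X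
  metrizable : MetrizableSpace X
  exists_arc : ∀ A : Set X, IsClosed A → A.Nonempty → A ≠ univ →
    ∃ (a b : X) (J : Set X), a ∈ A ∧ b ∉ A ∧ IsArcFromTo J a b

/-- A flow is minimal if all of its (full) orbits are dense. -/
def Flow.IsMinimal {X : Type u} [TopologicalSpace X] (φ : Flow ℝ X) : Prop :=
  ∀ x : X, Dense (range fun t : ℝ => φ t x)

/-- A nondegenerate metrizable continuum: a metrizable, compact and connected space with at least
two points. -/
structure IsNondegenerateMetrizableContinuum (X : Type u) [TopologicalSpace X] : Prop where
  nondegenerate : Nontrivial X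
  metrizable : MetrizableSpace X
  compact : CompactSpace X
  connected : ConnectedSpace X

/-- The composant of `p`: the union of all proper subcontinua of `X` that contain `p`. -/
def composant {X : Type u} [TopologicalSpace X] (p : X) : Set X :=
  ⋃₀ {K : Set X | IsCompact K ∧ IsConnected K ∧ K ≠ univ ∧ p ∈ K}

/-- Any two distinct points of `S` are the endpoints of an arc contained in `S`. -/
def IsArcwiseConnected {X : Type u} [TopologicalSpace X] (S : Set X) : Prop :=
  ∀ a ∈ S, ∀ b ∈ S, a ≠ b → ∃ J ⊆ S, IsArcFromTo J a b

/-- The inverse limit of the sequence `Y ← Y ← Y ← ⋯` with bonding maps `f 0, f 1, f 2, …`,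
a subspace of the product `∏ₙ Y`. -/
def InverseLimit {Y : Type} (f : ℕ → Y → Y) : Type :=
  {x : ℕ → Y // ∀ n, f n (x (n + 1)) = x n}

instance {Y : Type} [TopologicalSpace Y] (f : ℕ → Y → Y) : TopologicalSpace (InverseLimit f) :=
  instTopologicalSpaceSubtype

/-- A continuous open map of `Y` to itself that is not a homeomorphism. -/
structure IsNontrivialOpenBonding {Y : Type} [TopologicalSpace Y] (f : Y → Y) : Prop where
  continuous : Continuous f
  isOpenMap : IsOpenMap f
  not_isHomeomorph : ¬ IsHomeomorph f

/-- Solenoids: the inverse limits of circles with open bonding maps different from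
homeomorphisms. -/
def IsSolenoid (X : Type u) [TopologicalSpace X] : Prop :=
  ∃ f : ℕ → Circle → Circle, (∀ n, IsNontrivialOpenBonding (f n)) ∧ Nonempty (X ≃ₜ InverseLimit f)

/-- Knaster continua: the inverse limits of arcs with open bonding maps different from
homeomorphisms. -/
def IsKnasterContinuum (X : Type u) [TopologicalSpace X] : Prop :=
  ∃ f : ℕ → unitInterval → unitInterval,
    (∀ n, IsNontrivialOpenBonding (f n)) ∧ Nonempty (X ≃ₜ InverseLimit f)

/-! ### Arcs -/

/-! For a minimal flow, the orbit of a point `a` of `A` leaves `A`. The periods of `a` form a closed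
proper subgroup of `ℝ`, so 0 is isolated among them and short orbit segments are arcs. Such a
segment, started at the last time in `A` before a moment outside `A`, ends outside `A`.

In a continuum, boundary bumping makes every composant dense. The composant of a point of `A`
therefore meets the complement of `A`, and an arc inside the composant joins the two.

For solenoids and Knaster continua, every proper subcontinuum `K` turns out to be arcwise connected,
and arcs meeting at `p` then combine within the composant of `p`. By compactness, the projections of
`K` are proper subsets of `Y` from some index on. An open map of the circle cannot fold, and one of
the interval folds only over 0 and 1; properness of the projections then makes the bonding maps
injective on them from some index on. So a single projection embeds `K` in `Y` as a connected set,
where arcs are visible. -/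

theorem isArcFromTo_of_injOn_Icc {X : Type u} [TopologicalSpace X] [T2Space X] {a b : ℝ}
    (hab : a < b) {g : ℝ → X} (hg : ContinuousOn g (Icc a b)) (hinj : InjOn g (Icc a b)) :
    IsArcFromTo (g '' Icc a b) (g a) (g b) := by
  let e := (iccHomeoI a b hab).symm
  refine ⟨(Icc a b).domRestrict g ∘ e, ?_, ?_, ?_, ?_⟩
  · refine (Continuous.isClosedEmbedding ?_ ?_).isEmbedding
    · exact hg.domRestrict.comp e.continuous
    · exact hinj.injective.comp e.injective
  · rw [e.surjective.range_comp, range_domRestrict]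
  · simp [e]
  · simp [e]

theorem IsArcFromTo.symm {X : Type u} [TopologicalSpace X] {J : Set X} {a b : X}
    (h : IsArcFromTo J a b) : IsArcFromTo J b a := by
  obtain ⟨γ, hγ, hr, h0, h1⟩ := h
  refine ⟨γ ∘ unitInterval.symm, hγ.comp unitInterval.symmHomeomorph.isEmbedding, ?_, ?_, ?_⟩
  · exact (unitInterval.symmHomeomorph.surjective.range_comp γ).trans hr
  · simpa using h1
  · simpa using h0

/-- A parametrization of an arc extended to a map defined on the whole real line. -/
theorem IsArcFromTo.exists_real {X : Type u} [TopologicalSpace X] {J : Set X} {a b : X}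
    (h : IsArcFromTo J a b) : ∃ g : ℝ → X, Continuous g ∧ InjOn g (Icc 0 1) ∧
      g '' Icc 0 1 = J ∧ g 0 = a ∧ g 1 = b := by
  obtain ⟨γ, hγ, rfl, rfl, rfl⟩ := h
  have key : ∀ t (ht : t ∈ Icc (0 : ℝ) 1), IccExtend zero_le_one γ t = γ ⟨t, ht⟩ :=
    fun t ht => IccExtend_of_mem _ _ ht
  refine ⟨IccExtend zero_le_one γ, hγ.continuous.Icc_extend', ?_, ?_, ?_, ?_⟩
  · intro s hs t ht hst
    rw [key s hs, key t ht] at hst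
    exact congrArg Subtype.val (hγ.injective hst)
  · ext x
    constructor
    · rintro ⟨t, ht, rfl⟩
      exact ⟨⟨t, ht⟩, (key t ht).symm⟩
    · rintro ⟨t, rfl⟩
      exact ⟨t, t.2, key t t.2⟩
  · exact key 0 _
  · exact key 1 _

/-- Two arcs with a common endpoint contain an arc between their other endpoints: follow the
first arc up to its first point on the second one. -/
theorem IsArcFromTo.exists_trans {X : Type u} [TopologicalSpace X] [T2Space X] {J₁ J₂ : Set X}
    {a p b : X} (h₁ : IsArcFromTo J₁ a p) (h₂ : IsArcFromTo J₂ p b) (hab : a ≠ b) :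
    ∃ J ⊆ J₁ ∪ J₂, IsArcFromTo J a b := by
  obtain ⟨g₁, hc₁, hi₁, rfl, rfl, h₁p⟩ := h₁.exists_real
  obtain ⟨g₂, hc₂, hi₂, rfl, h₂p, rfl⟩ := h₂.exists_real
  have hJ₂ : IsClosed (g₂ '' Icc 0 1) := (isCompact_Icc.image hc₂).isClosed
  obtain ⟨t₀, ⟨ht₀, s₀, hs₀, hst⟩, hmin⟩ :=
    (isCompact_Icc.inter_right (hJ₂.preimage hc₁)).exists_isLeast
      (⟨1, right_mem_Icc.2 zero_le_one, 0, left_mem_Icc.2 zero_le_one, h₂p.trans h₁p.symm⟩ :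
        (Icc (0 : ℝ) 1 ∩ g₁ ⁻¹' (g₂ '' Icc 0 1)).Nonempty)
  let g : ℝ → X := fun x => if x ≤ t₀ then g₁ x else g₂ (s₀ + (x - t₀))
  have hgl : ∀ x, x ≤ t₀ → g x = g₁ x := fun x hx => if_pos hx
  have hgr : ∀ x, t₀ < x → g x = g₂ (s₀ + (x - t₀)) := fun x hx => if_neg hx.not_ge
  have hgc : Continuous g := by
    refine Continuous.if_le hc₁ (by fun_prop) continuous_id continuous_const ?_
    rintro x rfl
    simp [hst]
  -- The combined path degenerates only if `t₀ = 0` and `s₀ = 1`, in which case its two ends `a` and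
  -- `b` coincide.
  have hpos : 0 < t₀ + (1 - s₀) := by
    rcases ht₀.1.eq_or_lt with h | h
    · rcases hs₀.2.eq_or_lt with h' | h'
      · exact absurd (by rw [← h, h'] at hst; exact hst.symm) hab
      · linarith
    · linarith [hs₀.2]
  have aux : ∀ x ∈ Icc 0 (t₀ + (1 - s₀)), ∀ y ∈ Icc 0 (t₀ + (1 - s₀)), x ≤ t₀ → t₀ < y →
      g x ≠ g y := by
    intro x hx y hy hxt hty hxy
    rw [hgl x hxt, hgr y hty] at hxy
    have hy' : s₀ + (y - t₀) ∈ Icc (0 : ℝ) 1 := ⟨by linarith [hs₀.1], by linarith [hy.2]⟩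
    have : t₀ ≤ x := hmin ⟨⟨hx.1, hxt.trans ht₀.2⟩, _, hy', hxy.symm⟩
    rw [le_antisymm hxt this, ← hst] at hxy
    linarith [hi₂ hs₀ hy' hxy]
  have hinj : InjOn g (Icc 0 (t₀ + (1 - s₀))) := by
    intro x hx y hy hxy
    rcases le_or_gt x t₀ with hxt | hxt <;> rcases le_or_gt y t₀ with hyt | hyt
    · rw [hgl x hxt, hgl y hyt] at hxy
      exact hi₁ ⟨hx.1, hxt.trans ht₀.2⟩ ⟨hy.1, hyt.trans ht₀.2⟩ hxy
    · exact absurd hxy (aux x hx y hy hxt hyt)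
    · exact absurd hxy.symm (aux y hy x hx hyt hxt)
    · rw [hgr x hxt, hgr y hyt] at hxy
      have := hi₂ ⟨by linarith [hs₀.1], by linarith [hx.2]⟩
        ⟨by linarith [hs₀.1], by linarith [hy.2]⟩ hxy
      linarith
  have harc := isArcFromTo_of_injOn_Icc hpos hgc.continuousOn hinj
  have hend : g (t₀ + (1 - s₀)) = g₂ 1 := by
    rcases hs₀.2.eq_or_lt with h | h
    · rw [hgl _ (by linarith), ← h, sub_self, add_zero, ← hst]
    · rw [hgr _ (by linarith)]
      congr 1
      ring
  rw [hend, hgl 0 ht₀.1] at harc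
  refine ⟨_, ?_, harc⟩
  rintro _ ⟨x, hx, rfl⟩
  rcases le_or_gt x t₀ with hxt | hxt
  · rw [hgl x hxt]
    exact Or.inl ⟨x, ⟨hx.1, hxt.trans ht₀.2⟩, rfl⟩
  · rw [hgr x hxt]
    exact Or.inr ⟨_, ⟨by linarith [hs₀.1], by linarith [hx.2]⟩, rfl⟩

/-! ### Minimal flows -/

/-- The orbit of a point that is not fixed is locally injective. -/
theorem Flow.exists_forall_abs_lt_imp_eq_zero {X : Type u} [TopologicalSpace X] [T2Space X]
    (φ : Flow ℝ X) {a : X} (ha : ∃ t, φ t a ≠ a) :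
    ∃ ε > 0, ∀ t : ℝ, |t| < ε → φ t a = a → t = 0 := by
  by_contra! H
  -- The group of periods of `a` is closed. Were 0 not isolated in it, it would be dense, hence all
  -- of `ℝ`, and `a` would be fixed.
  let S : AddSubgroup ℝ :=
    { carrier := {t | φ t a = a}
      add_mem' := fun {s t} (hs : φ s a = a) (ht : φ t a = a) => by
        change φ (s + t) a = a
        rw [φ.map_add, ht, hs]
      zero_mem' := φ.map_zero_apply a
      neg_mem' := fun {s} (hs : φ s a = a) => by
        change φ (-s) a = a
        conv_lhs => rw [← hs]
        rw [← φ.map_add, neg_add_cancel, φ.map_zero_apply] }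
  have hS : IsClosed (S : Set ℝ) :=
    isClosed_eq (φ.continuous continuous_id continuous_const) continuous_const
  have hd : Dense (S : Set ℝ) := by
    refine AddSubgroup.dense_of_not_isolated_zero S fun ε hε => ?_
    obtain ⟨t, htε, hta, ht0⟩ := H ε hε
    have : |t| ∈ S := by
      rcases abs_choice t with h | h <;> rw [h]
      · exact hta
      · exact S.neg_mem hta
    exact ⟨|t|, this, abs_pos.2 ht0, htε⟩
  obtain ⟨t, ht⟩ := ha
  have : t ∈ (S : Set ℝ) := by rw [← hS.closure_eq, hd.closure_eq]; trivial
  exact ht this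

theorem Flow.IsMinimal.hasEnoughArcs {X : Type u} [TopologicalSpace X] [MetrizableSpace X]
    [Nontrivial X] {φ : Flow ℝ X} (hφ : φ.IsMinimal) : HasEnoughArcs X := by
  refine ⟨inferInstance, inferInstance, fun A hA ⟨a, ha⟩ hAu => ?_⟩
  obtain ⟨_, hT, T, rfl⟩ := (hφ a).inter_open_nonempty Aᶜ hA.isOpen_compl (nonempty_compl.2 hAu)
  obtain ⟨ε, hε, hinj⟩ := φ.exists_forall_abs_lt_imp_eq_zero
    (⟨T, fun h => hT (by simpa [h] using ha)⟩ : ∃ t, φ t a ≠ a)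
  have hT0 : 0 < |T| := abs_pos.2 fun h => hT (by simpa [h] using ha)
  -- Rescaling time by `T` treats both signs of `T` at once.
  let c : ℝ → X := fun s => φ (s * T) a
  have hc : Continuous c := φ.continuous (by fun_prop) continuous_const
  obtain ⟨s, ⟨hs, hsA⟩, hmax⟩ := (isCompact_Icc.inter_right (hA.preimage hc)).exists_isGreatest
    (⟨0, left_mem_Icc.2 zero_le_one, by simpa [c] using ha⟩ :
      (Icc (0 : ℝ) 1 ∩ c ⁻¹' A).Nonempty)
  have hs1 : s < 1 := hs.2.lt_of_ne fun h => hT (by simpa [h, c] using hsA)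
  -- The cap 1 keeps `r` in the range where `s` is the last parameter in `A`; the other bound keeps
  -- the elapsed time `(r - s) * |T|` below `ε`, so that the segment is injective.
  let r := min 1 (s + ε / (2 * |T|))
  have hsr : s < r := lt_min hs1 (by linarith [div_pos hε (mul_pos two_pos hT0)])
  have hrε : (r - s) * |T| < ε := by
    have h1 : r - s ≤ ε / (2 * |T|) := by linarith [min_le_right 1 (s + ε / (2 * |T|))]
    have h2 := mul_le_mul_of_nonneg_right h1 hT0.le
    have h3 : ε / (2 * |T|) * |T| = ε / 2 := by field_simp
    linarith
  have hci : InjOn c (Icc s r) := by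
    intro x hx y hy hxy
    have h1 : φ (-(y * T)) (c x) = a := by
      rw [hxy, ← φ.map_add, neg_add_cancel, φ.map_zero_apply]
    rw [← φ.map_add] at h1
    have h2 : -(y * T) + x * T = (x - y) * T := by ring
    rw [h2] at h1
    have h3 : |(x - y) * T| < ε := by
      rw [abs_mul]
      refine lt_of_le_of_lt (mul_le_mul_of_nonneg_right ?_ hT0.le) hrε
      rw [abs_le]
      constructor <;> linarith [hx.1, hx.2, hy.1, hy.2]
    rcases mul_eq_zero.1 (hinj _ h3 h1) with h | h
    · exact sub_eq_zero.1 h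
    · simp [h] at hT0
  refine ⟨c s, c r, _, hsA, fun hr => ?_,
    isArcFromTo_of_injOn_Icc hsr hc.continuousOn hci⟩
  exact hsr.not_ge (hmax ⟨⟨hs.1.trans hsr.le, min_le_left _ _⟩, hr⟩)

/-! ### Continua with arcwise connected composants -/

/-- Boundary bumping: in a connected compact Hausdorff space, the component of a point in the
complement of a nonempty open set `V` meets the closure of `V`. -/
theorem connectedComponentIn_compl_inter_closure_nonempty {X : Type u} [TopologicalSpace X]
    [T2Space X] [CompactSpace X] [PreconnectedSpace X] {V : Set X} (hV : IsOpen V)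
    (hne : V.Nonempty) {a : X} (ha : a ∉ V) :
    (connectedComponentIn Vᶜ a ∩ closure V).Nonempty := by
  by_contra H
  rw [not_nonempty_iff_eq_empty] at H
  have haV : a ∈ Vᶜ := ha
  let F : Set X := Vᶜ
  have hF : IsClosed F := hV.isClosed_compl
  have : CompactSpace F := isCompact_iff_compactSpace.1 hF.isCompact
  rw [connectedComponentIn_eq_image haV] at H
  let x : F := ⟨a, haV⟩
  let B : Set F := Subtype.val ⁻¹' closure V
  have hB : IsCompact B := (isClosed_closure.preimage continuous_subtype_val).isCompact
  have hdisj : B ∩ ⋂ s : { s : Set F // IsClopen s ∧ x ∈ s }, (s : Set F) = ∅ := by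
    rw [← connectedComponent_eq_iInter_isClopen]
    refine eq_empty_of_forall_notMem fun y hy => ?_
    have : (y : X) ∈ (∅ : Set X) := H ▸ ⟨⟨y, hy.2, rfl⟩, hy.1⟩
    exact this
  have : Nonempty { s : Set F // IsClopen s ∧ x ∈ s } := ⟨⟨univ, isClopen_univ, mem_univ _⟩⟩
  -- In a compact Hausdorff space a component is the intersection of the clopen sets around its
  -- point, so by compactness one clopen `D` already misses `closure V`.
  obtain ⟨⟨D, hD, hxD⟩, hBD⟩ := hB.elim_directed_family_closed
    (fun s : { s : Set F // IsClopen s ∧ x ∈ s } => (s : Set F)) (fun s => s.2.1.isClosed) hdisj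
    (fun s t => ⟨⟨s ∩ t, s.2.1.inter t.2.1, s.2.2, t.2.2⟩, inter_subset_left, inter_subset_right⟩)
  have hDV : ∀ y ∈ D, (y : X) ∉ closure V := fun y hy hyV => by
    have : y ∈ (∅ : Set F) := hBD ▸ ⟨hyV, hy⟩
    exact this
  obtain ⟨O, hO, hOD⟩ := isOpen_induced_iff.1 hD.isOpen
  -- Since `D` stays away from `closure V`, being open relative to `Vᶜ` is the same as being open in
  -- `X`. A clopen set that misses `V` contradicts connectedness.
  have hclopen : IsClopen (Subtype.val '' D) := by
    refine ⟨hF.isClosedMap_subtype_val _ hD.isClosed, ?_⟩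
    have : Subtype.val '' D = O ∩ (closure V)ᶜ := by
      ext y
      constructor
      · rintro ⟨y, hy, rfl⟩
        exact ⟨by rw [← hOD] at hy; exact hy, hDV y hy⟩
      · rintro ⟨hyO, hyV⟩
        refine ⟨⟨y, fun h => hyV (subset_closure h)⟩, ?_, rfl⟩
        rw [← hOD]
        exact hyO
    rw [this]
    exact hO.inter isClosed_closure.isOpen_compl
  have huniv := hclopen.eq_univ ⟨a, x, hxD, rfl⟩
  obtain ⟨v, hv⟩ := hne
  obtain ⟨y, -, rfl⟩ : v ∈ Subtype.val '' D := huniv ▸ mem_univ v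
  exact y.2 hv

/-- Given an open `U` missing `p`, remove a smaller open `V` whose closure lies in `U`: the
component of `p` in `Vᶜ` is a proper subcontinuum, and by boundary bumping it reaches `closure V`.
-/
theorem dense_composant {X : Type u} [TopologicalSpace X] [T2Space X] [CompactSpace X]
    [PreconnectedSpace X] [Nontrivial X] (p : X) : Dense (composant p) := by
  rw [dense_iff_inter_open]
  rintro U hU ⟨u, hu⟩
  by_cases hpU : p ∈ U
  · refine ⟨p, hpU, {p}, ⟨isCompact_singleton, isConnected_singleton, fun h => ?_, rfl⟩, rfl⟩
    exact not_subsingleton X (subsingleton_univ_iff.1 (h ▸ subsingleton_singleton))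
  obtain ⟨C, hCu, hC, hCU⟩ := exists_mem_nhds_isClosed_subset (hU.mem_nhds hu)
  obtain ⟨V, hVC, hV, huV⟩ := mem_nhds_iff.1 hCu
  have hVU : closure V ⊆ U := (closure_minimal hVC hC).trans hCU
  have hpV : p ∉ V := fun h => hpU (hVU (subset_closure h))
  obtain ⟨b, hbC, hbV⟩ :=
    connectedComponentIn_compl_inter_closure_nonempty hV ⟨u, huV⟩ hpV
  refine ⟨b, hVU hbV, connectedComponentIn Vᶜ p, ⟨?_, ?_, fun h => ?_, ?_⟩, hbC⟩
  · rw [connectedComponentIn_eq_image hpV]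
    exact (hV.isClosed_compl.isClosedMap_subtype_val _ isClosed_connectedComponent).isCompact
  · exact isConnected_connectedComponentIn_iff.2 hpV
  · exact connectedComponentIn_subset _ _ (h ▸ mem_univ u : u ∈ connectedComponentIn Vᶜ p) huV
  · exact mem_connectedComponentIn hpV

theorem mem_composant_self {X : Type u} [TopologicalSpace X] [Nontrivial X] (p : X) :
    p ∈ composant p := by
  refine ⟨{p}, ⟨isCompact_singleton, isConnected_singleton, fun h => ?_, rfl⟩, rfl⟩
  exact not_subsingleton X (subsingleton_univ_iff.1 (h ▸ subsingleton_singleton))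

theorem IsNondegenerateMetrizableContinuum.hasEnoughArcs {X : Type u} [TopologicalSpace X]
    (hX : IsNondegenerateMetrizableContinuum X)
    (h : ∀ p : X, IsArcwiseConnected (composant p)) : HasEnoughArcs X := by
  obtain ⟨_, _, _, _⟩ := hX
  refine ⟨inferInstance, inferInstance, fun A hA ⟨a, ha⟩ hAu => ?_⟩
  obtain ⟨b, hbA, hb⟩ :=
    (dense_composant a).inter_open_nonempty Aᶜ hA.isOpen_compl (nonempty_compl.2 hAu)
  obtain ⟨J, -, hJ⟩ := h a a (mem_composant_self a) b hb fun h => hbA (h ▸ ha)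
  exact ⟨a, b, J, ha, hbA, hJ⟩

/-- If distinct points of a proper subcontinuum can be joined by an arc inside it, then the
composants are arcwise connected. -/
theorem isArcwiseConnected_composant {X : Type u} [TopologicalSpace X] [T2Space X]
    (h : ∀ K : Set X, IsCompact K → IsConnected K → K ≠ univ → IsArcwiseConnected K) (p : X) :
    IsArcwiseConnected (composant p) := by
  have key : ∀ a ∈ composant p, a ≠ p → ∃ J ⊆ composant p, IsArcFromTo J a p := by
    rintro a ⟨K, hK, haK⟩ hap
    obtain ⟨J, hJK, hJ⟩ := h K hK.1 hK.2.1 hK.2.2.1 a haK p hK.2.2.2 hap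
    exact ⟨J, hJK.trans (subset_sUnion_of_mem hK), hJ⟩
  intro a ha b hb hab
  rcases eq_or_ne a p with rfl | hap
  · obtain ⟨J, hJ, harc⟩ := key b hb hab.symm
    exact ⟨J, hJ, harc.symm⟩
  rcases eq_or_ne b p with rfl | hbp
  · exact key a ha hab
  obtain ⟨J₁, hJ₁, harc₁⟩ := key a ha hap
  obtain ⟨J₂, hJ₂, harc₂⟩ := key b hb hbp
  obtain ⟨J, hJ, harc⟩ := harc₁.exists_trans harc₂.symm hab
  exact ⟨J, hJ.trans (union_subset hJ₁ hJ₂), harc⟩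


/-! ### Open maps of the interval and of the circle -/

/-- Used to show that a local maximum value of an open map must be the greatest element of the
target. -/
theorem Iic_notMem_nhds_of_lt {Y : Type*} [LinearOrder Y] [TopologicalSpace Y] [OrderTopology Y]
    [DenselyOrdered Y] {y z : Y} (hz : y < z) : Iic y ∉ 𝓝 y := by
  intro h
  have := nhdsGT_neBot_of_exists_gt ⟨z, hz⟩
  obtain ⟨w, hw, hw'⟩ :=
    Filter.nonempty_of_mem (Filter.inter_mem (mem_nhdsWithin_of_mem_nhds h)
      (self_mem_nhdsWithin : Ioi y ∈ 𝓝[>] y))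
  exact not_lt_of_ge hw hw'

theorem Ici_notMem_nhds_of_lt {Y : Type*} [LinearOrder Y] [TopologicalSpace Y] [OrderTopology Y]
    [DenselyOrdered Y] {y z : Y} (hz : z < y) : Ici y ∉ 𝓝 y :=
  Iic_notMem_nhds_of_lt (Y := Yᵒᵈ) (y := OrderDual.toDual y) (z := OrderDual.toDual z) hz

theorem IsPreconnected.isArcwiseConnected_unitInterval {S : Set unitInterval}
    (hS : IsPreconnected S) : IsArcwiseConnected S := by
  have key : ∀ a ∈ S, ∀ b ∈ S, a < b → ∃ J ⊆ S, IsArcFromTo J a b := by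
    intro a ha b hb hab
    have hab' : (a : ℝ) < b := hab
    have hproj : ∀ x ∈ Icc (a : ℝ) b, x ∈ Icc (0 : ℝ) 1 :=
      fun x hx => ⟨a.2.1.trans hx.1, hx.2.trans b.2.2⟩
    have harc := isArcFromTo_of_injOn_Icc hab' (g := projIcc (0 : ℝ) 1 zero_le_one)
      continuous_projIcc.continuousOn fun x hx y hy hxy => by
        rw [projIcc_of_mem _ (hproj x hx), projIcc_of_mem _ (hproj y hy)] at hxy
        exact congrArg Subtype.val hxy
    rw [projIcc_val, projIcc_val] at harc
    refine ⟨_, ?_, harc⟩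
    rintro _ ⟨x, hx, rfl⟩
    rw [projIcc_of_mem _ (hproj x hx)]
    exact hS.Icc_subset ha hb ⟨hx.1, hx.2⟩
  intro a ha b hb hab
  rcases hab.lt_or_gt with h | h
  · exact key a ha b hb h
  · obtain ⟨J, hJ, harc⟩ := key b hb a ha h
    exact ⟨J, hJ, harc.symm⟩

section Interval

open unitInterval

variable {f : I → I} (hf : Continuous f) (ho : IsOpenMap f)
include hf ho

/-- Between two points with the same value, an open self-map of the interval attains `0` or `1`,
and a value different from the common one. -/
theorem IsOpenMap.exists_mem_Ioo_eq_zero_or_one {a b : I} (hab : a < b) (h : f a = f b) :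
    ∃ c ∈ Ioo a b, (f c = 0 ∨ f c = 1) ∧ f c ≠ f a := by
  have hopen : IsOpen (f '' Ioo a b) := ho _ isOpen_Ioo
  have hmax : ∀ c ∈ Ioo a b, (∀ x ∈ Icc a b, f x ≤ f c) → f c = 1 := by
    intro c hc hcmax
    by_contra hne
    refine Iic_notMem_nhds_of_lt (lt_of_le_of_ne le_one' hne) (Filter.mem_of_superset
      (hopen.mem_nhds (mem_image_of_mem f hc)) ?_)
    rintro _ ⟨x, hx, rfl⟩
    exact hcmax x (Ioo_subset_Icc_self hx)
  have hmin : ∀ c ∈ Ioo a b, (∀ x ∈ Icc a b, f c ≤ f x) → f c = 0 := by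
    intro c hc hcmin
    by_contra hne
    refine Ici_notMem_nhds_of_lt (lt_of_le_of_ne nonneg' (Ne.symm hne)) (Filter.mem_of_superset
      (hopen.mem_nhds (mem_image_of_mem f hc)) ?_)
    rintro _ ⟨x, hx, rfl⟩
    exact hcmin x (Ioo_subset_Icc_self hx)
  obtain ⟨C, hC, hCmax⟩ := isCompact_Icc.exists_isMaxOn (nonempty_Icc.2 hab.le) hf.continuousOn
  obtain ⟨c, hc, hcmin⟩ := isCompact_Icc.exists_isMinOn (nonempty_Icc.2 hab.le) hf.continuousOn
  have hmem : ∀ x ∈ Icc a b, f x ≠ f a → x ∈ Ioo a b := fun x hx hne =>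
    ⟨hx.1.lt_of_ne fun hh => hne (by rw [hh]), hx.2.lt_of_ne fun hh => hne (by rw [hh, h])⟩
  by_cases hCa : f C = f a
  · by_cases hca : f c = f a
    -- On a constant stretch an interior point is both a maximum and a minimum, which would give it
    -- both values 0 and 1.
    · have hconst : ∀ x ∈ Icc a b, f x = f a := fun x hx =>
        le_antisymm (hCa ▸ hCmax hx) (hca ▸ hcmin hx)
      obtain ⟨m, hm⟩ := nonempty_Ioo.2 hab
      have hm' := hconst m (Ioo_subset_Icc_self hm)
      have h1 := hmax m hm fun x hx => by rw [hm', hconst x hx]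
      have h0 := hmin m hm fun x hx => by rw [hm', hconst x hx]
      exact absurd (h0.symm.trans h1) zero_ne_one
    · exact ⟨c, hmem c hc hca, Or.inl (hmin c (hmem c hc hca) fun x hx => hcmin hx), hca⟩
  · exact ⟨C, hmem C hC hCa, Or.inr (hmax C (hmem C hC hCa) fun x hx => hCmax hx), hCa⟩

/-- Two equal values would enclose a fold, and folds occur only over 0 and 1. -/
theorem IsOpenMap.injOn_of_forall_ne {S : Set I} (hS : IsPreconnected S)
    (h : ∀ x ∈ S, f x ≠ 0 ∧ f x ≠ 1) : InjOn f S := by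
  have key : ∀ a ∈ S, ∀ b ∈ S, a < b → f a ≠ f b := by
    intro a ha b hb hab hfab
    obtain ⟨c, hc, hc', -⟩ := ho.exists_mem_Ioo_eq_zero_or_one hf hab hfab
    have := h c (hS.Icc_subset ha hb (Ioo_subset_Icc_self hc))
    exact hc'.elim this.1 this.2
  intro a ha b hb hab
  by_contra hne
  rcases Ne.lt_or_gt hne with hlt | hlt
  · exact key a ha b hb hlt hab
  · exact key b hb a ha hlt hab.symm

/-- An open self-map of the interval maps endpoints to endpoints. -/
theorem IsOpenMap.apply_endpoint {p : I} (hp : p = 0 ∨ p = 1) : f p = 0 ∨ f p = 1 := by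
  by_contra! hne
  have hU : IsOpen (f ⁻¹' {0, 1}ᶜ) := (toFinite ({0, 1} : Set I)).isClosed.isOpen_compl.preimage hf
  have hpU : p ∈ f ⁻¹' {0, 1}ᶜ := by simpa using hne
  obtain ⟨ε, hε, hball⟩ := Metric.mem_nhds_iff.1 (hU.mem_nhds hpU)
  obtain ⟨S, hSo, hpS, hord, hSU⟩ : ∃ S : Set I, IsOpen S ∧ p ∈ S ∧ OrdConnected S ∧
      S ⊆ f ⁻¹' {0, 1}ᶜ := by
    refine ⟨_, Metric.isOpen_ball, Metric.mem_ball_self hε, ?_, hball⟩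
    have : Metric.ball p ε = Subtype.val ⁻¹' Ioo ((p : ℝ) - ε) (p + ε) := by
      rw [← Real.ball_eq_Ioo]
      rfl
    rw [this]
    exact ordConnected_Ioo.preimage_mono (Subtype.mono_coe _)
  have hSc : IsPreconnected S := hord.isPreconnected
  have hinj : InjOn f S := ho.injOn_of_forall_ne hf hSc fun x hx => by
    simpa using hSU hx
  obtain ⟨V, hV, hVS⟩ : ∃ V ∈ 𝓝 (f p), V ⊆ f '' S := ⟨_, (ho S hSo).mem_nhds ⟨p, hpS, rfl⟩, le_rfl⟩
  have hpos : 0 < f p := lt_of_le_of_ne nonneg' (Ne.symm hne.1)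
  have hlt : f p < 1 := lt_of_le_of_ne le_one' hne.2
  -- Openness provides values on both sides of `f p`. Between `u` and `v` the value `f p` is
  -- attained, by injectivity only at `p`; but an endpoint lying between `u` and `v` must equal one
  -- of them.
  obtain ⟨u, hu, hup⟩ : ∃ u ∈ S, f u < f p := by
    by_contra! H
    refine Ici_notMem_nhds_of_lt hpos (Filter.mem_of_superset hV fun y hy => ?_)
    obtain ⟨x, hx, rfl⟩ := hVS hy
    exact H x hx
  obtain ⟨v, hv, hvp⟩ : ∃ v ∈ S, f p < f v := by
    by_contra! H
    refine Iic_notMem_nhds_of_lt hlt (Filter.mem_of_superset hV fun y hy => ?_)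
    obtain ⟨x, hx, rfl⟩ := hVS hy
    exact H x hx
  have hsub : uIcc u v ⊆ S := hord.uIcc_subset hu hv
  obtain ⟨x, hx, hxp⟩ : f p ∈ f '' uIcc u v :=
    (isPreconnected_uIcc.image f hf.continuousOn).Icc_subset
      ⟨u, left_mem_uIcc, rfl⟩ ⟨v, right_mem_uIcc, rfl⟩ ⟨hup.le, hvp.le⟩
  obtain rfl : x = p := hinj (hsub hx) hpS hxp
  rcases hp with rfl | rfl
  · rcases inf_le_iff.1 hx.1 with h | h
    · rw [le_antisymm h nonneg'] at hup
      exact hup.false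
    · rw [le_antisymm h nonneg'] at hvp
      exact hvp.false
  · rcases le_sup_iff.1 hx.2 with h | h
    · rw [le_antisymm le_one' h] at hup
      exact hup.false
    · rw [le_antisymm le_one' h] at hvp
      exact hvp.false

/-- A fold in `S` and the endpoint in `S` both have values in `{0, 1}`. These values agree, because
`f '' S` is connected and proper; but then a further point between the two takes the other value of
`{0, 1}`. -/
theorem IsOpenMap.injOn_of_endpoint_mem {S : Set I} (hS : IsPreconnected S)
    (hp : (0 : I) ∈ S ∨ (1 : I) ∈ S) (hfS : f '' S ≠ univ) : InjOn f S := by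
  have hSf : IsPreconnected (f '' S) := hS.image f hf.continuousOn
  have hsep : ∀ x ∈ S, ∀ y ∈ S, f x = 0 → f y = 1 → False := by
    intro x hx y hy hx0 hy1
    refine hfS (eq_univ_of_forall fun z => ?_)
    exact hSf.Icc_subset ⟨x, hx, hx0⟩ ⟨y, hy, hy1⟩ ⟨nonneg', le_one'⟩
  have hsame : ∀ x ∈ S, ∀ y ∈ S, (f x = 0 ∨ f x = 1) → (f y = 0 ∨ f y = 1) → f x = f y := by
    rintro x hx y hy (h | h) (h' | h')
    · rw [h, h']
    · exact (hsep x hx y hy h h').elim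
    · exact (hsep y hy x hx h' h).elim
    · rw [h, h']
  have key : ∀ a ∈ S, ∀ b ∈ S, a < b → f a ≠ f b := by
    intro a ha b hb hab hfab
    obtain ⟨c, hc, hc', -⟩ := ho.exists_mem_Ioo_eq_zero_or_one hf hab hfab
    have hcS : c ∈ S := hS.Icc_subset ha hb (Ioo_subset_Icc_self hc)
    rcases hp with hp | hp
    · have hp' := ho.apply_endpoint hf (Or.inl rfl : (0 : I) = 0 ∨ (0 : I) = 1)
      obtain ⟨d, hd, hd', hne⟩ := ho.exists_mem_Ioo_eq_zero_or_one hf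
        (lt_of_le_of_lt nonneg' hc.1) (hsame _ hp _ hcS hp' hc')
      exact hne (hsame _ (hS.Icc_subset hp hcS (Ioo_subset_Icc_self hd)) _ hp hd' hp')
    · have hp' := ho.apply_endpoint hf (Or.inr rfl : (1 : I) = 0 ∨ (1 : I) = 1)
      obtain ⟨d, hd, hd', hne⟩ := ho.exists_mem_Ioo_eq_zero_or_one hf
        (lt_of_lt_of_le hc.2 le_one') (hsame _ hcS _ hp hc' hp')
      exact hne (hsame _ (hS.Icc_subset hcS hp (Ioo_subset_Icc_self hd)) _ hcS hd' hc')
  intro a ha b hb hab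
  by_contra hne
  rcases Ne.lt_or_gt hne with hlt | hlt
  · exact key a ha b hb hlt hab
  · exact key b hb a ha hlt hab.symm

end Interval

/-- An angle coordinate on the circle, continuous away from a given point `q`. -/
theorem Circle.exists_angle (q : Circle) : ∃ (L : Circle → ℝ) (e : ℝ → Circle), Continuous e ∧
    ContinuousOn L {q}ᶜ ∧ (∀ z, e (L z) = z) ∧ (∀ z, z ≠ q → L z ∈ Ioo (-Real.pi) Real.pi) ∧
    ∀ x ∈ Ioo (-Real.pi) Real.pi, L (e x) = x := by
  -- This rotation carries `q` to -1, so the branch cut of `Complex.arg` is met only at `q`.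
  let r : Circle → Circle := fun z => z / q * Circle.exp Real.pi
  have hrc : Continuous r := by fun_prop
  have hr : ∀ z, z ≠ q → Complex.arg (r z) ≠ Real.pi := by
    intro z hz h
    have h1 := Circle.exp_arg (r z)
    rw [h] at h1
    exact hz (div_eq_one.1 (mul_eq_right.1 h1.symm))
  refine ⟨fun z => Complex.arg (r z), fun x => Circle.exp x / Circle.exp Real.pi * q,
    by fun_prop, ?_, ?_, ?_, ?_⟩
  · intro z hz
    refine ContinuousAt.continuousWithinAt ?_
    refine ContinuousAt.comp (g := Complex.arg) (f := fun z => (r z : ℂ)) ?_ ?_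
    · exact Complex.continuousAt_arg
        (Complex.mem_slitPlane_iff_arg.2 ⟨hr z hz, Circle.coe_ne_zero _⟩)
    · exact (continuous_subtype_val.comp hrc).continuousAt
  · intro z
    change Circle.exp (Complex.arg (r z)) / _ * q = z
    rw [Circle.exp_arg]
    simp [r]
  · intro z hz
    exact ⟨Complex.neg_pi_lt_arg _, (Complex.arg_le_pi _).lt_of_ne (hr z hz)⟩
  · intro x hx
    have : r (Circle.exp x / Circle.exp Real.pi * q) = Circle.exp x := by simp [r]
    simp only [this]
    exact Circle.arg_exp hx.1 hx.2.le

theorem IsPreconnected.isArcwiseConnected_circle {S : Set Circle} (hS : IsPreconnected S)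
    (hne : S ≠ univ) : IsArcwiseConnected S := by
  obtain ⟨q, hq⟩ := (ne_univ_iff_exists_notMem S).1 hne
  obtain ⟨L, e, he, hL, heL, hLm, hLe⟩ := Circle.exists_angle q
  have hSq : S ⊆ {q}ᶜ := fun z hz h => hq (h ▸ hz)
  have hLS : IsPreconnected (L '' S) := hS.image L (hL.mono hSq)
  have key : ∀ a ∈ S, ∀ b ∈ S, L a < L b → ∃ J ⊆ S, IsArcFromTo J a b := by
    intro a ha b hb hab
    have hsub : Icc (L a) (L b) ⊆ L '' S := hLS.Icc_subset ⟨a, ha, rfl⟩ ⟨b, hb, rfl⟩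
    have harc := isArcFromTo_of_injOn_Icc hab he.continuousOn (g := e) fun x hx y hy hxy => by
      obtain ⟨z, hz, rfl⟩ := hsub hx
      obtain ⟨w, hw, rfl⟩ := hsub hy
      rw [heL, heL] at hxy
      rw [hxy]
    rw [heL, heL] at harc
    refine ⟨_, ?_, harc⟩
    rintro _ ⟨x, hx, rfl⟩
    obtain ⟨z, hz, rfl⟩ := hsub hx
    rwa [heL]
  intro a ha b hb hab
  have hLab : L a ≠ L b := fun h => hab (by rw [← heL a, h, heL])
  rcases hLab.lt_or_gt with h | h
  · exact key a ha b hb h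
  · obtain ⟨J, hJ, harc⟩ := key b hb a ha h
    exact ⟨J, hJ, harc.symm⟩

/-- In angle coordinates cut at a point outside `S` and at one outside `f '' S`, a repeated value
would produce an interior extremum. The angles range over an open interval, so openness rules it
out. -/
theorem IsOpenMap.injOn_circle {f : Circle → Circle} (hf : Continuous f) (ho : IsOpenMap f)
    {S : Set Circle} (hS : IsPreconnected S) (hne : S ≠ univ) (hfS : f '' S ≠ univ) :
    InjOn f S := by
  obtain ⟨q, hq⟩ := (ne_univ_iff_exists_notMem S).1 hne
  obtain ⟨q', hq'⟩ := (ne_univ_iff_exists_notMem (f '' S)).1 hfS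
  obtain ⟨L, e, he, hL, heL, hLm, hLe⟩ := Circle.exists_angle q
  obtain ⟨L', e', he', hL', heL', hLm', hLe'⟩ := Circle.exists_angle q'
  have hSq : S ⊆ {q}ᶜ := fun z hz h => hq (h ▸ hz)
  have hSq' : ∀ z ∈ S, f z ≠ q' := fun z hz h => hq' ⟨z, hz, h⟩
  have hLS : IsPreconnected (L '' S) := hS.image L (hL.mono hSq)
  have key : ∀ a ∈ S, ∀ b ∈ S, L a < L b → f a ≠ f b := by
    intro a ha b hb hab hfab
    have hsub : Icc (L a) (L b) ⊆ L '' S := hLS.Icc_subset ⟨a, ha, rfl⟩ ⟨b, hb, rfl⟩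
    have heS : ∀ x ∈ Icc (L a) (L b), e x ∈ S := by
      intro x hx
      obtain ⟨z, hz, rfl⟩ := hsub hx
      rwa [heL]
    have hhc : ContinuousOn (fun x => L' (f (e x))) (Icc (L a) (L b)) :=
      hL'.comp (hf.comp he).continuousOn fun x hx => hSq' _ (heS x hx)
    obtain ⟨c, hc, hext⟩ := exists_Ioo_extr_on_Icc hab hhc (by simp only [heL, hfab])
    have hopen : IsOpen (e '' Ioo (L a) (L b)) := by
      have : e '' Ioo (L a) (L b) = {q}ᶜ ∩ L ⁻¹' Ioo (L a) (L b) := by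
        ext z
        constructor
        · rintro ⟨x, hx, rfl⟩
          obtain ⟨w, hw, rfl⟩ := hsub (Ioo_subset_Icc_self hx)
          rw [heL]
          exact ⟨hSq hw, hx⟩
        · rintro ⟨-, hz⟩
          exact ⟨L z, hz, heL z⟩
      rw [this]
      exact hL.isOpen_inter_preimage isOpen_compl_singleton isOpen_Ioo
    have hyc := hLm' _ (hSq' _ (heS c (Ioo_subset_Icc_self hc)))
    set y := L' (f (e c)) with hy
    -- Every angle close to the extremal one is attained over the segment, on both sides of it.
    have hnhds : {w | w ∈ Ioo (-Real.pi) Real.pi ∧ e' w ∈ f '' (e '' Ioo (L a) (L b))} ∈ 𝓝 y := by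
      refine Filter.inter_mem (isOpen_Ioo.mem_nhds hyc)
        (he'.continuousAt.preimage_mem_nhds (t := f '' (e '' Ioo (L a) (L b))) ?_)
      rw [hy, heL']
      exact (ho _ hopen).mem_nhds ⟨_, ⟨c, hc, rfl⟩, rfl⟩
    have hval : ∀ w, w ∈ Ioo (-Real.pi) Real.pi ∧ e' w ∈ f '' (e '' Ioo (L a) (L b)) →
        ∃ x ∈ Icc (L a) (L b), L' (f (e x)) = w := by
      rintro w ⟨hw, _, ⟨x, hx, rfl⟩, hxw⟩
      exact ⟨x, Ioo_subset_Icc_self hx, by rw [hxw, hLe' w hw]⟩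
    rcases hext with hmin | hmax
    · refine Ici_notMem_nhds_of_lt hyc.1 (Filter.mem_of_superset hnhds fun w hw => ?_)
      obtain ⟨x, hx, rfl⟩ := hval w hw
      exact hmin hx
    · refine Iic_notMem_nhds_of_lt hyc.2 (Filter.mem_of_superset hnhds fun w hw => ?_)
      obtain ⟨x, hx, rfl⟩ := hval w hw
      exact hmax hx
  intro a ha b hb hab
  by_contra hne
  have hLab : L a ≠ L b := fun h => hne (by rw [← heL a, h, heL])
  rcases hLab.lt_or_gt with h | h
  · exact key a ha b hb h hab
  · exact key b hb a ha h hab.symm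


/-! ### Subcontinua of inverse limits -/

/-- A compact subset of an inverse limit with infinitely many full projections is everything. -/
theorem IsCompact.eq_univ_of_frequently_image_eq_univ {X Y : Type*} [TopologicalSpace X]
    [T2Space X] [TopologicalSpace Y] [T2Space Y] {f : ℕ → Y → Y} {π : ℕ → X → Y}
    (hπ : ∀ n, Continuous (π n))
    (hπf : ∀ n x, f n (π (n + 1) x) = π n x) (hsep : ∀ x y, (∀ n, π n x = π n y) → x = y)
    {K : Set X} (hK : IsCompact K) (h : ∀ N, ∃ n ≥ N, π n '' K = univ) : K = univ := by
  refine eq_univ_of_forall fun x => ?_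
  -- These compact sets decrease with `n`, so nonemptiness at infinitely many indices is enough; a
  -- common point has all the projections of `x`.
  let t : ℕ → Set X := fun n => K ∩ π n ⁻¹' {π n x}
  have htd : ∀ n, t (n + 1) ⊆ t n := by
    rintro n y ⟨hyK, hy⟩
    exact ⟨hyK, by rw [mem_preimage, ← hπf n y, hy, hπf]; rfl⟩
  have htc : ∀ n, IsClosed (t n) := fun n => hK.isClosed.inter (isClosed_singleton.preimage (hπ n))
  have htn : ∀ n, (t n).Nonempty := by
    intro N
    obtain ⟨n, hn, hu⟩ := h N
    obtain ⟨y, hyK, hy⟩ : π n x ∈ π n '' K := hu ▸ mem_univ _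
    exact ⟨y, antitone_nat_of_succ_le htd hn ⟨hyK, hy⟩⟩
  obtain ⟨y, hy⟩ := IsCompact.nonempty_iInter_of_sequence_nonempty_isCompact_isClosed t htd htn
    (hK.of_isClosed_subset (htc 0) inter_subset_left) htc
  rw [mem_iInter] at hy
  rw [← hsep y x fun n => (hy n).2]
  exact (hy 0).1

/-- Equality of the `M`-th coordinates climbs to higher indices by injectivity and descends to lower
ones through the bonding maps. -/
theorem injOn_projection_of_injOn_bonding {X Y : Type*} {f : ℕ → Y → Y} {π : ℕ → X → Y}
    (hπf : ∀ n x, f n (π (n + 1) x) = π n x)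
    (hsep : ∀ x y, (∀ n, π n x = π n y) → x = y) {K : Set X} {M : ℕ}
    (h : ∀ n ≥ M, InjOn (f n) (π (n + 1) '' K)) : InjOn (π M) K := by
  intro x hx y hy hxy
  have hup : ∀ k, π (M + k) x = π (M + k) y := by
    intro k
    induction k with
    | zero => exact hxy
    | succ k ih =>
      refine h (M + k) (by omega) ⟨x, hx, rfl⟩ ⟨y, hy, rfl⟩ ?_
      exact (hπf _ x).trans (ih.trans (hπf _ y).symm)
  have hdown : ∀ k n, π (n + k) x = π (n + k) y → π n x = π n y := by
    intro k
    induction k with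
    | zero => exact fun n hn => hn
    | succ k ih =>
      intro n hn
      exact ih n ((hπf _ x).symm.trans ((congrArg (f (n + k)) hn).trans (hπf _ y)))
  exact hsep x y fun n => hdown M n (by rw [add_comm]; exact hup n)

/-- By compactness `g` embeds `K`, so arcs in the image lift. -/
theorem IsArcwiseConnected.of_image {X : Type*} {Y : Type*} [TopologicalSpace X]
    [TopologicalSpace Y] [T2Space Y] {g : X → Y} (hg : Continuous g) {K : Set X}
    (hK : IsCompact K) (hinj : InjOn g K) (h : IsArcwiseConnected (g '' K)) :
    IsArcwiseConnected K := by
  intro a ha b hb hab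
  obtain ⟨J, hJK, γ, hγ, rfl, h0, h1⟩ :=
    h (g a) ⟨a, ha, rfl⟩ (g b) ⟨b, hb, rfl⟩ fun h => hab (hinj ha hb h)
  have : CompactSpace K := isCompact_iff_compactSpace.1 hK
  have he : IsEmbedding (K.domRestrict g) :=
    (Continuous.isClosedEmbedding (hg.comp continuous_subtype_val) hinj.injective).isEmbedding
  have hlift : ∀ t, ∃ x : K, K.domRestrict g x = γ t := fun t => by
    obtain ⟨x, hx, hxt⟩ := hJK ⟨t, rfl⟩
    exact ⟨⟨x, hx⟩, hxt⟩
  choose δ hδ using hlift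
  have hcomp : K.domRestrict g ∘ δ = γ := funext hδ
  have hδe : IsEmbedding δ := by
    refine IsEmbedding.of_comp ?_ he.continuous (hcomp ▸ hγ)
    rw [he.isInducing.continuous_iff, hcomp]
    exact hγ.continuous
  have hend : ∀ t (x : X) (hx : x ∈ K), γ t = g x → (δ t : X) = x := fun t x hx ht =>
    hinj (δ t).2 hx ((hδ t).trans ht)
  refine ⟨range fun t => (δ t : X), ?_, fun t => (δ t : X), IsEmbedding.subtypeVal.comp hδe, rfl,
    hend 0 a ha h0, hend 1 b hb h1⟩
  rintro _ ⟨t, rfl⟩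
  exact (δ t).2

theorem isArcwiseConnected_of_circle_projections {X : Type u} [TopologicalSpace X] [T2Space X]
    {f : ℕ → Circle → Circle} (hf : ∀ n, Continuous (f n)) (ho : ∀ n, IsOpenMap (f n))
    {π : ℕ → X → Circle} (hπ : ∀ n, Continuous (π n))
    (hπf : ∀ n x, f n (π (n + 1) x) = π n x) (hsep : ∀ x y, (∀ n, π n x = π n y) → x = y)
    {K : Set X} (hK : IsCompact K) (hKc : IsPreconnected K) (hKu : K ≠ univ) :
    IsArcwiseConnected K := by
  obtain ⟨N, hN⟩ : ∃ N, ∀ n ≥ N, π n '' K ≠ univ := by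
    by_contra! H
    exact hKu (hK.eq_univ_of_frequently_image_eq_univ hπ hπf hsep H)
  have hconn : ∀ n, IsPreconnected (π n '' K) := fun n => hKc.image _ (hπ n).continuousOn
  have himg : ∀ n, f n '' (π (n + 1) '' K) = π n '' K := fun n => by
    rw [image_image]
    simp only [hπf]
  refine IsArcwiseConnected.of_image (hπ N) hK ?_ ((hconn N).isArcwiseConnected_circle (hN N le_rfl))
  refine injOn_projection_of_injOn_bonding hπf hsep fun n hn => ?_
  refine (ho n).injOn_circle (hf n) (hconn _) (hN _ (by omega)) ?_
  rw [himg]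
  exact hN n hn

theorem isArcwiseConnected_of_interval_projections {X : Type u} [TopologicalSpace X] [T2Space X]
    {f : ℕ → unitInterval → unitInterval} (hf : ∀ n, Continuous (f n))
    (ho : ∀ n, IsOpenMap (f n)) {π : ℕ → X → unitInterval} (hπ : ∀ n, Continuous (π n))
    (hπf : ∀ n x, f n (π (n + 1) x) = π n x) (hsep : ∀ x y, (∀ n, π n x = π n y) → x = y)
    {K : Set X} (hK : IsCompact K) (hKc : IsPreconnected K) (hKu : K ≠ univ) :
    IsArcwiseConnected K := by
  obtain ⟨N, hN⟩ : ∃ N, ∀ n ≥ N, π n '' K ≠ univ := by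
    by_contra! H
    exact hKu (hK.eq_univ_of_frequently_image_eq_univ hπ hπf hsep H)
  have hconn : ∀ n, IsPreconnected (π n '' K) := fun n => hKc.image _ (hπ n).continuousOn
  have himg : ∀ n, f n '' (π (n + 1) '' K) = π n '' K := fun n => by
    rw [image_image]
    simp only [hπf]
  obtain ⟨M, hM⟩ : ∃ M, ∀ n ≥ M, InjOn (f n) (π (n + 1) '' K) := by
    -- If one projection misses both endpoints, so do all later ones, since bonding maps send
    -- endpoints to endpoints, and no fold can occur. Otherwise every projection contains an
    -- endpoint, and properness of the images excludes folds.
    by_cases H : ∃ m, 0 ∉ π m '' K ∧ 1 ∉ π m '' K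
    · obtain ⟨m, hm⟩ := H
      have hmiss : ∀ n ≥ m, 0 ∉ π n '' K ∧ 1 ∉ π n '' K := by
        intro n hn
        induction n, hn using Nat.le_induction with
        | base => exact hm
        | succ n hn ih =>
          have hend : ∀ p : unitInterval, (p = 0 ∨ p = 1) → p ∉ π (n + 1) '' K := by
            intro p hp hpK
            have hfp : f n p ∈ π n '' K := himg n ▸ mem_image_of_mem (f n) hpK
            rcases (ho n).apply_endpoint (hf n) hp with h | h
            · exact ih.1 (h ▸ hfp)
            · exact ih.2 (h ▸ hfp)
          exact ⟨hend 0 (Or.inl rfl), hend 1 (Or.inr rfl)⟩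
      refine ⟨m, fun n hn => (ho n).injOn_of_forall_ne (hf n) (hconn _) fun x hx => ?_⟩
      have hfx : f n x ∈ π n '' K := himg n ▸ mem_image_of_mem (f n) hx
      exact ⟨fun h => (hmiss n hn).1 (h ▸ hfx), fun h => (hmiss n hn).2 (h ▸ hfx)⟩
    · refine ⟨N, fun n hn => (ho n).injOn_of_endpoint_mem (hf n) (hconn _) ?_ ?_⟩
      · by_contra! h
        exact H ⟨n + 1, h⟩
      · rw [himg]
        exact hN n hn
  exact IsArcwiseConnected.of_image (hπ M) hK (injOn_projection_of_injOn_bonding hπf hsep hM)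
    (hconn M).isArcwiseConnected_unitInterval

/-! ### Inverse limits are continua -/

/-- Disjoint open sets separating the intersection would, by compactness, already cover some `P n`.
-/
theorem isPreconnected_iInter_of_antitone {Z : Type*} [TopologicalSpace Z] [T2Space Z]
    {P : ℕ → Set Z} (hP : Antitone P) (hc : ∀ n, IsCompact (P n))
    (hconn : ∀ n, IsPreconnected (P n)) : IsPreconnected (⋂ n, P n) := by
  have hcl : IsClosed (⋂ n, P n) := isClosed_iInter fun n => (hc n).isClosed
  have hcpt : IsCompact (⋂ n, P n) := (hc 0).of_isClosed_subset hcl (iInter_subset P 0)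
  rw [isPreconnected_iff_subset_of_fully_disjoint_closed hcl]
  intro A B hA hB hAB hdisj
  obtain ⟨U, V, hU, hV, hAU, hBV, hUV⟩ := SeparatedNhds.of_isCompact_isCompact
    (hcpt.inter_right hA) (hcpt.inter_right hB) (hdisj.mono inter_subset_right inter_subset_right)
  obtain ⟨n, hn⟩ : ∃ n, P n ⊆ U ∪ V := by
    refine exists_subset_nhds_of_isCompact hP.directed_ge hc fun x hx => ?_
    refine (hU.union hV).mem_nhds ?_
    rcases hAB hx with h | h
    · exact Or.inl (hAU ⟨hx, h⟩)
    · exact Or.inr (hBV ⟨hx, h⟩)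
  have hsub : ⋂ n, P n ⊆ P n := iInter_subset P n
  rcases (hconn n).subset_or_subset hU hV hUV hn with h | h
  · left
    intro x hx
    refine (hAB hx).resolve_right fun hxB => ?_
    exact hUV.le_bot ⟨h (hsub hx), hBV ⟨hx, hxB⟩⟩
  · right
    intro x hx
    refine (hAB hx).resolve_left fun hxA => ?_
    exact hUV.le_bot ⟨hAU ⟨hx, hxA⟩, h (hsub hx)⟩

section InverseLimit

variable {Y : Type} {f : ℕ → Y → Y}

/-- The sequence whose coordinates below `n` are obtained from the `n`-th coordinate of `x` by
applying the bonding maps. -/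
def truncate (f : ℕ → Y → Y) : ℕ → (ℕ → Y) → ℕ → Y
  | 0, x => x
  | n + 1, x => truncate f n (Function.update x n (f n (x (n + 1))))

theorem continuous_truncate [TopologicalSpace Y] (hf : ∀ n, Continuous (f n)) (n : ℕ) :
    Continuous (truncate f n) := by
  induction n with
  | zero => exact continuous_id
  | succ n ih =>
    exact ih.comp (continuous_id.update n ((hf n).comp (continuous_apply (n + 1))))

theorem truncate_apply_of_le {n k : ℕ} (h : n ≤ k) (x : ℕ → Y) : truncate f n x k = x k := by
  induction n generalizing x with
  | zero => rfl
  | succ n ih =>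
    rw [truncate, ih (by omega), Function.update_of_ne (by omega)]

theorem bonding_truncate {n m : ℕ} (h : m < n) (x : ℕ → Y) :
    f m (truncate f n x (m + 1)) = truncate f n x m := by
  induction n generalizing x with
  | zero => omega
  | succ n ih =>
    rcases Nat.lt_succ_iff_lt_or_eq.1 h with h | rfl
    · exact ih h _
    · rw [truncate, truncate_apply_of_le (by omega), truncate_apply_of_le le_rfl,
        Function.update_self, Function.update_of_ne (by omega)]

theorem truncate_eq_self {n : ℕ} {x : ℕ → Y} (h : ∀ m < n, f m (x (m + 1)) = x m) :
    truncate f n x = x := by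
  induction n with
  | zero => rfl
  | succ n ih =>
    rw [truncate, h n (by omega), Function.update_eq_self, ih fun m hm => h m (by omega)]

theorem range_truncate (n : ℕ) :
    range (truncate f n) = {x | ∀ m < n, f m (x (m + 1)) = x m} := by
  ext x
  constructor
  · rintro ⟨y, rfl⟩ m hm
    exact bonding_truncate hm y
  · exact fun hx => ⟨x, truncate_eq_self hx⟩

/-- This exhibits the inverse limit as a decreasing intersection of continuous images of the full
product, which is how it inherits connectedness. -/
theorem iInter_range_truncate :
    ⋂ n, range (truncate f n) = {x | ∀ n, f n (x (n + 1)) = x n} := by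
  ext x
  simp only [range_truncate, mem_iInter, mem_ofPred_eq]
  exact ⟨fun h n => h (n + 1) n n.lt_succ_self, fun h _ m _ => h m⟩

theorem antitone_range_truncate : Antitone fun n => range (truncate f n) := by
  intro m n hmn
  simp only [range_truncate]
  exact fun x hx k hk => hx k (hk.trans_le hmn)

theorem InverseLimit.exists_apply_zero_eq (hs : ∀ n, Function.Surjective (f n)) (y : Y) :
    ∃ x : InverseLimit f, x.1 0 = y :=
  ⟨⟨fun n => Nat.rec y (fun n z => Function.surjInv (hs n) z) n,
    fun n => Function.surjInv_eq (hs n) _⟩, rfl⟩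

/-- The range is both compact and open, hence clopen. -/
theorem IsOpenMap.surjective_of_compact_connected {Z : Type*} [TopologicalSpace Z]
    [CompactSpace Z] [T2Space Z] [ConnectedSpace Z] {g : Z → Z} (hg : Continuous g)
    (ho : IsOpenMap g) : Function.Surjective g := by
  rw [← range_eq_univ]
  exact IsClopen.eq_univ ⟨(isCompact_range hg).isClosed, ho.isOpen_range⟩ (range_nonempty g)

theorem InverseLimit.isNondegenerateMetrizableContinuum [TopologicalSpace Y] [MetrizableSpace Y]
    [CompactSpace Y] [ConnectedSpace Y] [Nontrivial Y] (hf : ∀ n, Continuous (f n))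
    (hs : ∀ n, Function.Surjective (f n)) :
    IsNondegenerateMetrizableContinuum (InverseLimit f) := by
  have hpre : IsPreconnected {x : ℕ → Y | ∀ n, f n (x (n + 1)) = x n} := by
    rw [← iInter_range_truncate]
    exact isPreconnected_iInter_of_antitone antitone_range_truncate
      (fun n => isCompact_range (continuous_truncate hf n))
      fun n => isPreconnected_range (continuous_truncate hf n)
  have hclosed : IsClosed {x : ℕ → Y | ∀ n, f n (x (n + 1)) = x n} := by
    rw [ofPred_forall]
    exact isClosed_iInter fun n =>
      isClosed_eq ((hf n).comp (continuous_apply _)) (continuous_apply _)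
  have hnon : Nontrivial (InverseLimit f) := by
    obtain ⟨y, z, hyz⟩ := exists_pair_ne Y
    obtain ⟨x, rfl⟩ := InverseLimit.exists_apply_zero_eq hs y
    obtain ⟨x', rfl⟩ := InverseLimit.exists_apply_zero_eq hs z
    exact ⟨x, x', fun h => hyz (by rw [h])⟩
  refine ⟨hnon, ?_, ?_, ?_⟩
  · exact (IsEmbedding.subtypeVal :
      IsEmbedding (Subtype.val : {x : ℕ → Y // ∀ n, f n (x (n + 1)) = x n} → _)).metrizableSpace
  · exact isCompact_iff_compactSpace.1 hclosed.isCompact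
  · have := isPreconnected_iff_preconnectedSpace.1 hpre
    exact @ConnectedSpace.mk (InverseLimit f) _ this hnon.to_nonempty

end InverseLimit

theorem IsNondegenerateMetrizableContinuum.of_homeomorph {X : Type*} {Z : Type*}
    [TopologicalSpace X] [TopologicalSpace Z] (hZ : IsNondegenerateMetrizableContinuum Z)
    (e : X ≃ₜ Z) : IsNondegenerateMetrizableContinuum X := by
  obtain ⟨_, _, _, _⟩ := hZ
  exact ⟨e.toEquiv.nontrivial, e.isEmbedding.metrizableSpace, e.symm.compactSpace,
    e.symm.surjective.connectedSpace e.symm.continuous⟩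

theorem isArcwiseConnected_composant_of_homeomorph_inverseLimit {X : Type u} [TopologicalSpace X]
    [T2Space X] {Y : Type} [TopologicalSpace Y] {f : ℕ → Y → Y} (e : X ≃ₜ InverseLimit f)
    (h : ∀ π : ℕ → X → Y, (∀ n, Continuous (π n)) → (∀ n x, f n (π (n + 1) x) = π n x) →
      (∀ x y, (∀ n, π n x = π n y) → x = y) → ∀ K : Set X, IsCompact K → IsPreconnected K →
      K ≠ univ → IsArcwiseConnected K) (p : X) : IsArcwiseConnected (composant p) := by
  refine isArcwiseConnected_composant (fun K hK hKc hKu => ?_) p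
  refine h (fun n x => (e x).1 n) (fun n => ?_) (fun n x => (e x).2 n) (fun x y hxy => ?_)
    K hK hKc.isPreconnected hKu
  · exact (continuous_apply n).comp (continuous_subtype_val.comp e.continuous)
  · exact e.injective (Subtype.ext (funext hxy))

theorem IsSolenoid.continuum_and_composants {X : Type u} [TopologicalSpace X]
    (hX : IsSolenoid X) : IsNondegenerateMetrizableContinuum X ∧
      ∀ p : X, IsArcwiseConnected (composant p) := by
  obtain ⟨f, hf, ⟨e⟩⟩ := hX
  have hc : ∀ n, Continuous (f n) := fun n => (hf n).continuous
  have ho : ∀ n, IsOpenMap (f n) := fun n => (hf n).isOpenMap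
  have : Nontrivial Circle := ⟨1, Circle.exp Real.pi, by
    intro h
    have := congrArg (fun z : Circle => (z : ℂ)) h
    norm_num at this⟩
  have hX := (InverseLimit.isNondegenerateMetrizableContinuum hc fun n =>
    (ho n).surjective_of_compact_connected (hc n)).of_homeomorph e
  have := hX.metrizable
  exact ⟨hX, isArcwiseConnected_composant_of_homeomorph_inverseLimit e fun π hπ hπf hsep K =>
    isArcwiseConnected_of_circle_projections hc ho hπ hπf hsep⟩

theorem IsKnasterContinuum.continuum_and_composants {X : Type u} [TopologicalSpace X]
    (hX : IsKnasterContinuum X) : IsNondegenerateMetrizableContinuum X ∧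
      ∀ p : X, IsArcwiseConnected (composant p) := by
  obtain ⟨f, hf, ⟨e⟩⟩ := hX
  have hc : ∀ n, Continuous (f n) := fun n => (hf n).continuous
  have ho : ∀ n, IsOpenMap (f n) := fun n => (hf n).isOpenMap
  have hX := (InverseLimit.isNondegenerateMetrizableContinuum hc fun n =>
    (ho n).surjective_of_compact_connected (hc n)).of_homeomorph e
  have := hX.metrizable
  exact ⟨hX, isArcwiseConnected_composant_of_homeomorph_inverseLimit e fun π hπ hπf hsep K =>
    isArcwiseConnected_of_interval_projections hc ho hπ hπf hsep⟩

theorem corollary2p8 :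
    (∀ (X : Type u) [TopologicalSpace X] [MetrizableSpace X] [Nontrivial X],
      (∃ φ : Flow ℝ X, φ.IsMinimal) → HasEnoughArcs X) ∧
    (∀ (X : Type u) [TopologicalSpace X], IsNondegenerateMetrizableContinuum X →
      (∀ p : X, IsArcwiseConnected (composant p)) → HasEnoughArcs X) ∧
    (∀ (X : Type u) [TopologicalSpace X], IsSolenoid X ∨ IsKnasterContinuum X →
      IsNondegenerateMetrizableContinuum X ∧
      (∀ p : X, IsArcwiseConnected (composant p)) ∧
      HasEnoughArcs X) := by
  refine ⟨fun X _ _ _ ⟨φ, hφ⟩ => hφ.hasEnoughArcs, fun X _ hX h => hX.hasEnoughArcs h,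
    fun X _ hX => ?_⟩
  have h := hX.elim IsSolenoid.continuum_and_composants IsKnasterContinuum.continuum_and_composants
  exact ⟨h.1, h.2, h.1.hasEnoughArcs h.2⟩
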